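/- Theorem 3.1. Vector spaces are real and operators are linear and bounded. Let $E$ and $F$ be Banach lattices, with duals $E'$, $F'$ (ordered by $f\le g$ iff $f(x)\le g(x)$ for all $x\ge 0$) and positive cones $E_+$, $F'_+$, etc. Operators $E\to F$ are ordered by $S\le T$ iff $Sx\le Tx$ for all $x\in E_+$. The adjoint of $T$ is $T'$, and a sequence $(x_n)$ in a vector lattice is disjoint if $|x_m|\wedge|x_n|=0$ for $m\neq n$; "w-null" and "w$^*$-null" mean weakly and weak$^*$ convergent to $0$. An operator $T:E\to F$ belongs to - $[\mathrm{PSP}](E,F)$ if $\|Tx_n\|\to 0$ for each w-null $(x_n)$ in $E_+$; - $[\mathrm{DPSP}](E,F)$ if $\|T'f_n\|\to 0$ for each w$^*$-null $(f_n)$ in $F'_+$; - $[\mathrm{DDSP}](E,F)$ if $\|T'f_n\|\to 0$ for each disjoint w$^*$-null $(f_n)$ in $F'$; - $[\mathrm{PGP}](E,F)$ if $(T'f_n)$ is w-null for each w$^*$-null $(f_n)$ in $F'_+$; - $[\mathrm{DGP}](E,F)$ if $(T'f_n)$ is w-null for each disjoint w$^*$-null $(f_n)$ in $F'$; - $[\mathrm{dswl}](E,F)$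 if $(|Tx_n|)$ is w-null for each disjoint w-null $(x_n)$ in $E$; - $[\mathrm{swl}](E,F)$ if $(|Tx_n|)$ is w-null for each w-null $(x_n)$ in $E$; - $[\mathrm{sw}^*\mathrm{l}](E,F)$ if $(|T'f_n|)$ is w$^*$-null for each w$^*$-null $(f_n)$ in $F'$; - $[\mathrm{d}](E,F)$ if $(|T'f_n|)$ is w$^*$-null for each disjoint w$^*$-null $(f_n)$ in $F'$; - $[\text{bi-sP}](E,F)$ if $f_n(Tx_n)\to 0$ for each w$^*$-null $(f_n)$ in $F'_+$ and each disjoint w-null $(x_n)$ in $E$. A set $\mathcal P$ of operators $E\to F$ satisfies the domination property if $0\le S\le T\in\mathcal P$ implies $S\in\mathcal P$ for all operators $S,T:E\to F$. The Banach lattice $F$ has property (d) if $(|f_n|)$ is w$^*$-null for each disjoint w$^*$-null $(f_n)$ in $F'$; $E$ has sequentially w-continuous lattice operations if $(|x_n|)$ is w-null for each w-null $(x_n)$ in $E$; $F'$ has sequentially w$^*$-continuous lattice operations if $(|f_n|)$ is w$^*$-null for each w$^*$-null $(f_n)$ in $F'$. The following sets of operators satisfy the domination property: 1. $[\mathrm{PSP}](E,F)$;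 2. $[\mathrm{DPSP}](E,F)$; 3. $[\mathrm{DDSP}](E,F)$, if $F$ has property (d); 4. $[\mathrm{PGP}](E,F)$; 5. $[\mathrm{DGP}](E,F)$, if $F$ has property (d); 6. $[\mathrm{dswl}](E,F)$; 7. $[\mathrm{swl}](E,F)$, if $E$ has sequentially w-continuous lattice operations; 8. $[\mathrm{sw}^*\mathrm{l}](E,F)$, if $F'$ has sequentially w$^*$-continuous lattice operations; 9. $[\mathrm{d}](E,F)$, if $F$ has property (d); 10. $[\text{bi-sP}](E,F)$. -/

import Mathlib

open Filter Topology

namespace BanachLatticeOps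

/-! ### The order on operators and the lattice structure of the dual -/

section Order

variable {E F : Type*}
  [NormedAddCommGroup E] [NormedSpace ℝ E] [Lattice E] [HasSolidNorm E] [IsOrderedAddMonoid E]

/-- The usual order on bounded operators between Banach lattices:
`S ≤ T` iff `S x ≤ T x` for all `x ∈ E₊`. For `F = ℝ` it is the order of the dual `E'`. -/
instance instOperatorOrder [NormedAddCommGroup F] [NormedSpace ℝ F] [PartialOrder F] :
    PartialOrder (E →L[ℝ] F) where
  le S T := ∀ x : E, 0 ≤ x → S x ≤ T x
  le_refl _ _ _ := le_rfl
  le_trans _ _ _ h₁ h₂ x hx := (h₁ x hx).trans (h₂ x hx)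
  le_antisymm S T h₁ h₂ := by
    ext x
    have key : ∀ y : E, 0 ≤ y → S y = T y := fun y hy => le_antisymm (h₁ y hy) (h₂ y hy)
    rw [← posPart_sub_negPart x, map_sub, map_sub, key _ (posPart_nonneg x),
      key _ (negPart_nonneg x)]

/-- `posSup f x = sup {f u : 0 ≤ u ≤ x}`, the value of `f⁺` at `x ≥ 0`. -/
noncomputable def posSup (f : E →L[ℝ] ℝ) (x : E) : ℝ :=
  sSup (f '' Set.Icc 0 x)

theorem posSup_bound (f : E →L[ℝ] ℝ) {x u : E} (hu : u ∈ Set.Icc 0 x) :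
    f u ≤ ‖f‖ * ‖x‖ := by
  have h1 : ‖u‖ ≤ ‖x‖ := norm_le_norm_of_abs_le_abs (by
    rw [abs_of_nonneg hu.1, abs_of_nonneg (hu.1.trans hu.2)]; exact hu.2)
  calc f u ≤ ‖f u‖ := Real.le_norm_self _
    _ ≤ ‖f‖ * ‖u‖ := f.le_opNorm u
    _ ≤ ‖f‖ * ‖x‖ := by gcongr

theorem le_posSup (f : E →L[ℝ] ℝ) {x u : E} (hu : u ∈ Set.Icc 0 x) : f u ≤ posSup f x :=
  le_csSup ⟨‖f‖ * ‖x‖, by rintro _ ⟨v, hv, rfl⟩; exact posSup_bound f hv⟩ ⟨u, hu, rfl⟩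

theorem posSup_le (f : E →L[ℝ] ℝ) {x : E} (hx : 0 ≤ x) {c : ℝ}
    (h : ∀ u ∈ Set.Icc 0 x, f u ≤ c) : posSup f x ≤ c :=
  csSup_le ⟨f 0, 0, ⟨le_rfl, hx⟩, rfl⟩ (by rintro _ ⟨v, hv, rfl⟩; exact h v hv)

theorem posSup_nonneg (f : E →L[ℝ] ℝ) {x : E} (hx : 0 ≤ x) : 0 ≤ posSup f x := by
  simpa using le_posSup f (u := 0) ⟨le_rfl, hx⟩

theorem posSup_add (f : E →L[ℝ] ℝ) {a b : E} (ha : 0 ≤ a) (hb : 0 ≤ b) :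
    posSup f (a + b) = posSup f a + posSup f b := by
  apply le_antisymm
  · refine posSup_le f (add_nonneg ha hb) fun u hu => ?_
    have h1 : f (u ⊓ a) ≤ posSup f a := le_posSup f ⟨le_inf hu.1 ha, inf_le_right⟩
    have h2 : f (u - u ⊓ a) ≤ posSup f b := by
      refine le_posSup f ⟨sub_nonneg.2 inf_le_left, ?_⟩
      rw [sub_le_iff_le_add, inf_comm, ← sub_le_iff_le_add']
      refine le_inf ?_ ?_
      · rw [sub_le_iff_le_add, add_comm]; simpa [add_comm] using hu.2
      · simpa using hb
    have h3 : f u = f (u ⊓ a) + f (u - u ⊓ a) := by rw [← map_add]; congr 1; abel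
    linarith
  · rw [← le_sub_iff_add_le]
    refine posSup_le f ha fun u hu => ?_
    rw [le_sub_iff_add_le, add_comm, ← le_sub_iff_add_le]
    refine posSup_le f hb fun v hv => ?_
    rw [le_sub_iff_add_le, add_comm, ← map_add]
    exact le_posSup f ⟨add_nonneg hu.1 hv.1, add_le_add hu.2 hv.2⟩

theorem posSup_sub_eq (f : E →L[ℝ] ℝ) {a b c d : E} (ha : 0 ≤ a) (hb : 0 ≤ b) (hc : 0 ≤ c)
    (hd : 0 ≤ d) (h : a - b = c - d) :
    posSup f a - posSup f b = posSup f c - posSup f d := by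
  have h1 : a + d = c + b := by
    rw [sub_eq_sub_iff_add_eq_add] at h; exact h
  have h2 := congrArg (posSup f) h1
  rw [posSup_add f ha hd, posSup_add f hc hb] at h2
  linarith

/-- The positive part `f⁺ = f ⊔ 0` of a bounded functional, as an additive map:
`x ↦ f⁺(x⁺) - f⁺(x⁻)`. -/
noncomputable def posAddHom (f : E →L[ℝ] ℝ) : E →+ ℝ :=
  AddMonoidHom.mk' (fun x => posSup f x⁺ - posSup f x⁻) (by
    intro x y
    have h := posSup_sub_eq f (a := (x + y)⁺) (b := (x + y)⁻) (c := x⁺ + y⁺) (d := x⁻ + y⁻)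
      (posPart_nonneg _) (negPart_nonneg _)
      (add_nonneg (posPart_nonneg _) (posPart_nonneg _))
      (add_nonneg (negPart_nonneg _) (negPart_nonneg _))
      (by rw [posPart_sub_negPart, add_sub_add_comm, posPart_sub_negPart, posPart_sub_negPart])
    rw [posSup_add f (posPart_nonneg _) (posPart_nonneg _),
      posSup_add f (negPart_nonneg _) (negPart_nonneg _)] at h
    linarith)

theorem posAddHom_apply_of_nonneg (f : E →L[ℝ] ℝ) {x : E} (hx : 0 ≤ x) :
    posAddHom f x = posSup f x := by
  have h := posSup_sub_eq f (a := x⁺) (b := x⁻) (c := x) (d := 0)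
    (posPart_nonneg _) (negPart_nonneg _) hx le_rfl (by rw [posPart_sub_negPart, sub_zero])
  have h0 : posSup f (0 : E) = 0 := by
    have := posSup_add f (le_refl (0 : E)) (le_refl 0)
    rw [add_zero] at this
    linarith
  rw [h0, sub_zero] at h
  exact h

theorem posAddHom_norm_le (f : E →L[ℝ] ℝ) (x : E) : ‖posAddHom f x‖ ≤ ‖f‖ * ‖x‖ := by
  have hp := posSup_nonneg f (posPart_nonneg x)
  have hn := posSup_nonneg f (negPart_nonneg x)
  have hpn : ‖x⁺‖ ≤ ‖x‖ := norm_le_norm_of_abs_le_abs (by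
    rw [abs_of_nonneg (posPart_nonneg x)]
    exact sup_le (le_abs_self x) (abs_nonneg x))
  have hnn : ‖x⁻‖ ≤ ‖x‖ := norm_le_norm_of_abs_le_abs (by
    rw [abs_of_nonneg (negPart_nonneg x)]
    exact sup_le (neg_le_abs x) (abs_nonneg x))
  have hp' : posSup f x⁺ ≤ ‖f‖ * ‖x‖ :=
    posSup_le f (posPart_nonneg x) fun u hu => (posSup_bound f hu).trans (by gcongr)
  have hn' : posSup f x⁻ ≤ ‖f‖ * ‖x‖ :=
    posSup_le f (negPart_nonneg x) fun u hu => (posSup_bound f hu).trans (by gcongr)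
  change ‖posSup f x⁺ - posSup f x⁻‖ ≤ _
  rw [Real.norm_eq_abs, abs_le]
  constructor <;> linarith

/-- The positive part `f⁺ = f ⊔ 0` of a bounded functional, as a bounded functional. -/
noncomputable def dualPos (f : E →L[ℝ] ℝ) : E →L[ℝ] ℝ :=
  (posAddHom f).toRealLinearMap
    (AddMonoidHomClass.continuous_of_bound (posAddHom f) ‖f‖ (posAddHom_norm_le f))

theorem dualPos_apply (f : E →L[ℝ] ℝ) {x : E} (hx : 0 ≤ x) : dualPos f x = posSup f x :=
  posAddHom_apply_of_nonneg f hx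

theorem le_dualPos (f : E →L[ℝ] ℝ) : f ≤ dualPos f := fun x hx => by
  rw [dualPos_apply f hx]
  exact le_posSup f ⟨hx, le_rfl⟩

theorem dualPos_nonneg (f : E →L[ℝ] ℝ) : 0 ≤ dualPos f := fun x hx => by
  rw [dualPos_apply f hx]
  exact posSup_nonneg f hx

theorem dualPos_le {f g : E →L[ℝ] ℝ} (hfg : f ≤ g) (hg : 0 ≤ g) : dualPos f ≤ g :=
  fun x hx => by
    rw [dualPos_apply f hx]
    refine posSup_le f hx fun u hu => (hfg u hu.1).trans ?_
    have h : 0 ≤ g (x - u) := hg (x - u) (sub_nonneg.2 hu.2)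
    rw [map_sub] at h
    exact sub_nonneg.1 h

/-- The dual `E'` of a Banach lattice is a vector lattice for the order of functionals. -/
noncomputable instance instDualLattice : Lattice (E →L[ℝ] ℝ) where
  toPartialOrder := instOperatorOrder
  sup f g := g + dualPos (f - g)
  inf f g := f - dualPos (f - g)
  le_sup_left f g x hx := by
    have := le_dualPos (f - g) x hx
    simp only [sub_apply, add_apply] at this ⊢
    linarith
  le_sup_right f g x hx := by
    have := dualPos_nonneg (f - g) x hx
    simp only [zero_apply, add_apply] at this ⊢
    linarith
  sup_le f g h hf hg x hx := by
    have := dualPos_le (f := f - g) (g := h - g)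
      (fun y hy => by simpa using hf y hy) (fun y hy => by simpa using hg y hy) x hx
    simp only [sub_apply, add_apply] at this ⊢
    linarith
  inf_le_left f g x hx := by
    have := dualPos_nonneg (f - g) x hx
    simp only [zero_apply, sub_apply] at this ⊢
    linarith
  inf_le_right f g x hx := by
    have := le_dualPos (f - g) x hx
    simp only [sub_apply] at this ⊢
    linarith
  le_inf h f g hf hg x hx := by
    have := dualPos_le (f := f - g) (g := f - h)
      (fun y hy => sub_le_sub_left (hg y hy) (f y)) (fun y hy => sub_nonneg.2 (hf y hy)) x hx
    simp only [sub_apply] at this ⊢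
    linarith

end Order

/-! ### Null sequences and disjoint sequences -/

section Sequences

/-- `(x n)` is a weakly null sequence. -/
def WeakNull {X : Type*} [NormedAddCommGroup X] [NormedSpace ℝ X] (x : ℕ → X) : Prop :=
  Tendsto (fun n => toWeakSpace ℝ X (x n)) atTop (𝓝 0)

/-- `(f n)` is a weak* null sequence in the dual `X'`. -/
def WeakStarNull {X : Type*} [NormedAddCommGroup X] [NormedSpace ℝ X]
    (f : ℕ → StrongDual ℝ X) : Prop :=
  Tendsto (fun n => StrongDual.toWeakDual (f n)) atTop (𝓝 0)

/-- `(x n)` is a norm null sequence. -/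
def NormNull {X : Type*} [NormedAddCommGroup X] (x : ℕ → X) : Prop :=
  Tendsto (fun n => ‖x n‖) atTop (𝓝 0)

/-- The terms of `(x n)` are pairwise disjoint: `|x m| ⊓ |x n| = 0` for `m ≠ n`. -/
def DisjointSeq {α : Type*} [Lattice α] [AddGroup α] (x : ℕ → α) : Prop :=
  ∀ m n, m ≠ n → |x m| ⊓ |x n| = 0

end Sequences

/-! ### Properties of Banach lattices -/

section Properties

variable (E : Type*)
  [NormedAddCommGroup E] [NormedSpace ℝ E] [Lattice E] [HasSolidNorm E] [IsOrderedAddMonoid E]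

/-- `E` has sequentially w-continuous lattice operations. -/
def SeqWeakContLatticeOps : Prop :=
  ∀ x : ℕ → E, WeakNull x → WeakNull (fun n => |x n|)

/-- The dual `E'` has sequentially w*-continuous lattice operations. -/
def DualSeqWeakStarContLatticeOps : Prop :=
  ∀ f : ℕ → StrongDual ℝ E, WeakStarNull f → WeakStarNull (fun n => |f n|)

/-- `E` has the property (d). -/
def PropertyD : Prop :=
  ∀ f : ℕ → StrongDual ℝ E, DisjointSeq f → WeakStarNull f → WeakStarNull (fun n => |f n|)

end Properties

/-! ### Affiliated operators

For `T : X →L[ℝ] Y` and `f` in `Y'`, the adjoint value `T' f` is `f ∘L T`. -/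

section Operators

variable (X E Y F : Type*)
  [NormedAddCommGroup X] [NormedSpace ℝ X]
  [NormedAddCommGroup E] [NormedSpace ℝ E] [Lattice E] [HasSolidNorm E] [IsOrderedAddMonoid E]
  [NormedAddCommGroup Y] [NormedSpace ℝ Y]
  [NormedAddCommGroup F] [NormedSpace ℝ F] [Lattice F] [HasSolidNorm F] [IsOrderedAddMonoid F]

/-- [PSP]-operators from `E` to `Y`. -/
def PSP : Set (E →L[ℝ] Y) :=
  {T | ∀ x : ℕ → E, (∀ n, 0 ≤ x n) → WeakNull x → NormNull (fun n => T (x n))}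

/-- [DPSP]-operators from `X` to `F`. -/
def DPSP : Set (X →L[ℝ] F) :=
  {T | ∀ f : ℕ → StrongDual ℝ F, (∀ n, 0 ≤ f n) → WeakStarNull f →
    NormNull (fun n => f n ∘L T)}

/-- [DDSP]-operators from `X` to `F`. -/
def DDSP : Set (X →L[ℝ] F) :=
  {T | ∀ f : ℕ → StrongDual ℝ F, DisjointSeq f → WeakStarNull f →
    NormNull (fun n => f n ∘L T)}

/-- [PGP]-operators from `X` to `F`. -/
def PGP : Set (X →L[ℝ] F) :=
  {T | ∀ f : ℕ → StrongDual ℝ F, (∀ n, 0 ≤ f n) → WeakStarNull f →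
    WeakNull (fun n => f n ∘L T)}

/-- [DGP]-operators from `X` to `F`. -/
def DGP : Set (X →L[ℝ] F) :=
  {T | ∀ f : ℕ → StrongDual ℝ F, DisjointSeq f → WeakStarNull f →
    WeakNull (fun n => f n ∘L T)}

/-- [swl]-operators from `X` to `F`. -/
def SWL : Set (X →L[ℝ] F) :=
  {T | ∀ x : ℕ → X, WeakNull x → WeakNull (fun n => |T (x n)|)}

/-- [dswl]-operators from `E` to `F`. -/
def DSWL : Set (E →L[ℝ] F) :=
  {T | ∀ x : ℕ → E, DisjointSeq x → WeakNull x → WeakNull (fun n => |T (x n)|)}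

/-- [sw*l]-operators from `E` to `F`. -/
def SWstarL : Set (E →L[ℝ] F) :=
  {T | ∀ f : ℕ → StrongDual ℝ F, WeakStarNull f → WeakStarNull (fun n => |f n ∘L T|)}

/-- [d]-operators from `E` to `F`. -/
def DOp : Set (E →L[ℝ] F) :=
  {T | ∀ f : ℕ → StrongDual ℝ F, DisjointSeq f → WeakStarNull f →
    WeakStarNull (fun n => |f n ∘L T|)}

/-- [bi-sP]-operators from `E` to `F`. -/
def BiSP : Set (E →L[ℝ] F) :=
  {T | ∀ (f : ℕ → StrongDual ℝ F) (x : ℕ → E), (∀ n, 0 ≤ f n) → WeakStarNull f →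
    DisjointSeq x → WeakNull x → Tendsto (fun n => f n (T (x n))) atTop (𝓝 0)}

variable {E F} in
/-- The domination property of a set `P` of bounded operators: `0 ≤ S ≤ T ∈ P` implies
`S ∈ P`. -/
def DominationProperty (P : Set (E →L[ℝ] F)) : Prop :=
  ∀ S T : E →L[ℝ] F, 0 ≤ S → S ≤ T → T ∈ P → S ∈ P

end Operators

end BanachLatticeOps

/-!
If `0 ≤ S ≤ T` then `|S x| ≤ S |x| ≤ T |x|`, and dually `|f ∘ S| ≤ |f| ∘ S ≤ |f| ∘ T`. Each class is
therefore dominated as soon as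

* the sequence fed to `S` can be replaced by its sequence of absolute values, and
* the kind of convergence (norm, weak, weak*) passes from a positive sequence to every sequence that
  it dominates in absolute value.

For the second point, weak domination `WeakNull.of_abs_le` uses that each bounded functional `φ`
on a Banach lattice satisfies `|φ y| ≤ |φ| |y|`. It is applied to the dual `E'` as well, which is
why `E'` is equipped with its structure of a normed vector lattice.

For the first point, positive sequences need nothing, and the hypotheses on `F` or on `E`
are exactly what is needed for sequences in `F'` and for weakly null sequences in `E`. For
disjoint weakly null sequences in `E` no hypothesis is needed: `WeakNull.abs_of_disjointSeq`
shows that `(|x n|)` is again weakly null. Its proof splits a positive functional `f`: there is a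
functional `0 ≤ g ≤ f` that agrees with `f` on every `(x n)⁺` and vanishes on every `(x n)⁻`, so
that `f |x n| = 2 g (x n) - f (x n) → 0`.
-/

open Filter Topology

namespace BanachLatticeOps

/-! ### Positive operators -/

section Positive

variable {E F : Type*}
  [NormedAddCommGroup E] [NormedSpace ℝ E] [Lattice E] [IsOrderedAddMonoid E]
  [NormedAddCommGroup F] [NormedSpace ℝ F] [Lattice F] [IsOrderedAddMonoid F]

theorem apply_le_apply_of_nonneg {T : E →L[ℝ] F} (hT : 0 ≤ T) {x y : E} (h : x ≤ y) :
    T x ≤ T y := by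
  have h0 : 0 ≤ T (y - x) := hT (y - x) (sub_nonneg.2 h)
  rw [map_sub] at h0
  exact sub_nonneg.1 h0

theorem abs_apply_le_of_nonneg {T : E →L[ℝ] F} (hT : 0 ≤ T) (x : E) : |T x| ≤ T |x| := by
  refine sup_le (apply_le_apply_of_nonneg hT (le_abs_self x)) ?_
  rw [← map_neg]
  exact apply_le_apply_of_nonneg hT (neg_le_abs x)

theorem abs_apply_le_of_le {S T : E →L[ℝ] F} (hS : 0 ≤ S) (hST : S ≤ T) (x : E) :
    |S x| ≤ T |x| :=
  (abs_apply_le_of_nonneg hS x).trans (hST _ (abs_nonneg x))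

end Positive

/-! ### The dual as a normed vector lattice -/

section Dual

variable {E : Type*}
  [NormedAddCommGroup E] [NormedSpace ℝ E] [Lattice E] [HasSolidNorm E] [IsOrderedAddMonoid E]

instance instDualIsOrderedAddMonoid : IsOrderedAddMonoid (E →L[ℝ] ℝ) where
  add_le_add_left _ _ h c x hx := add_le_add_left (h x hx) (c x)

theorem dual_abs_nonneg (f : E →L[ℝ] ℝ) : 0 ≤ |f| := abs_nonneg f

theorem abs_dual_apply_le (f : E →L[ℝ] ℝ) (x : E) : |f x| ≤ |f| |x| := by
  have hp : ∀ y : E, 0 ≤ y → |f y| ≤ |f| y := fun y hy =>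
    sup_le (le_abs_self f y hy) (neg_le_abs f y hy)
  calc |f x| = |f x⁺ - f x⁻| := by rw [← map_sub, posPart_sub_negPart]
    _ ≤ |f x⁺| + |f x⁻| := abs_sub _ _
    _ ≤ |f| x⁺ + |f| x⁻ := add_le_add (hp _ (posPart_nonneg x)) (hp _ (negPart_nonneg x))
    _ = |f| |x| := by rw [← map_add, posPart_add_negPart]

/-- For `x ≥ 0`, the value `|f| x` is the supremum of `f (u - (x - u))` over `0 ≤ u ≤ x`, and
`|u - (x - u)| ≤ x`. -/
theorem dual_abs_apply_le (f : E →L[ℝ] ℝ) {x : E} (hx : 0 ≤ x) : |f| x ≤ ‖f‖ * ‖x‖ := by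
  have h1 : |f| x = -(f x) + posSup (f - -f) x := by
    rw [← dualPos_apply _ hx]
    rfl
  have h2 : posSup (f - -f) x ≤ ‖f‖ * ‖x‖ + f x := by
    refine posSup_le _ hx fun u hu => ?_
    have h3 : ‖u - (x - u)‖ ≤ ‖x‖ := by
      refine norm_le_norm_of_abs_le_abs ?_
      rw [abs_of_nonneg hx]
      refine sup_le ((sub_le_self _ (sub_nonneg.2 hu.2)).trans hu.2) ?_
      rw [neg_sub]
      exact (sub_le_self _ hu.1).trans (sub_le_self _ hu.1)
    have h4 : f (u - (x - u)) ≤ ‖f‖ * ‖x‖ :=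
      (Real.le_norm_self _).trans ((f.le_opNorm _).trans (by gcongr))
    simp only [map_sub, sub_neg_eq_add, add_apply] at h4 ⊢
    linarith
  linarith

instance instDualHasSolidNorm : HasSolidNorm (E →L[ℝ] ℝ) where
  solid f g h := by
    refine f.opNorm_le_bound (norm_nonneg g) fun x => ?_
    calc ‖f x‖ ≤ |f| |x| := abs_dual_apply_le f x
      _ ≤ |g| |x| := h _ (abs_nonneg x)
      _ ≤ ‖g‖ * ‖|x|‖ := dual_abs_apply_le g (abs_nonneg x)
      _ = ‖g‖ * ‖x‖ := by rw [norm_abs_eq_norm]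

end Dual

/-! ### Null sequences and domination -/

section Null

theorem weakNull_iff {X : Type*} [NormedAddCommGroup X] [NormedSpace ℝ X] {x : ℕ → X} :
    WeakNull x ↔ ∀ f : X →L[ℝ] ℝ, Tendsto (fun n => f (x n)) atTop (𝓝 0) := by
  have hinj : Function.Injective (topDualPairing ℝ X).flip := fun a b h => by
    by_contra hne
    obtain ⟨f, hf⟩ := SeparatingDual.exists_separating_of_ne (R := ℝ) hne
    exact hf (DFunLike.congr_fun h f)
  refine (WeakBilin.tendsto_iff_forall_eval_tendsto _ hinj (x := (0 : X))).trans
    (forall_congr' fun f => ?_)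
  rw [map_zero]
  rfl

theorem weakStarNull_iff {X : Type*} [NormedAddCommGroup X] [NormedSpace ℝ X]
    {f : ℕ → StrongDual ℝ X} :
    WeakStarNull f ↔ ∀ x : X, Tendsto (fun n => f n x) atTop (𝓝 0) :=
  tendsto_iff_forall_eval_tendsto_topDualPairing

theorem NormNull.of_abs_le {E : Type*} [NormedAddCommGroup E] [Lattice E] [HasSolidNorm E]
    {x y : ℕ → E} (hx : NormNull x) (h : ∀ n, |y n| ≤ x n) : NormNull y :=
  squeeze_zero (fun _ => norm_nonneg _)
    (fun n => norm_le_norm_of_abs_le_abs ((h n).trans (le_abs_self _))) hx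

variable {E : Type*}
  [NormedAddCommGroup E] [NormedSpace ℝ E] [Lattice E] [HasSolidNorm E] [IsOrderedAddMonoid E]

theorem WeakNull.of_abs_le {x y : ℕ → E} (hx : WeakNull x) (h : ∀ n, |y n| ≤ x n) :
    WeakNull y := by
  rw [weakNull_iff] at hx ⊢
  intro f
  refine squeeze_zero_norm (fun n => ?_) (hx |f|)
  exact (abs_dual_apply_le f (y n)).trans (apply_le_apply_of_nonneg (dual_abs_nonneg f) (h n))

theorem WeakStarNull.of_abs_le {f g : ℕ → StrongDual ℝ E} (hf : WeakStarNull f)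
    (h : ∀ n, |g n| ≤ f n) : WeakStarNull g := by
  rw [weakStarNull_iff] at hf ⊢
  intro x
  refine squeeze_zero_norm (fun n => ?_) (hf |x|)
  exact (abs_dual_apply_le (g n) x).trans (h n _ (abs_nonneg x))

theorem WeakNull.map {X Y : Type*} [NormedAddCommGroup X] [NormedSpace ℝ X]
    [NormedAddCommGroup Y] [NormedSpace ℝ Y] {x : ℕ → X} (hx : WeakNull x) (T : X →L[ℝ] Y) :
    WeakNull fun n => T (x n) :=
  weakNull_iff.2 fun f => weakNull_iff.1 hx (f ∘L T)

theorem WeakStarNull.comp {X Y : Type*} [NormedAddCommGroup X] [NormedSpace ℝ X]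
    [NormedAddCommGroup Y] [NormedSpace ℝ Y] {f : ℕ → StrongDual ℝ Y} (hf : WeakStarNull f)
    (T : X →L[ℝ] Y) : WeakStarNull fun n => f n ∘L T :=
  weakStarNull_iff.2 fun x => weakStarNull_iff.1 hf (T x)

theorem DisjointSeq.abs {α : Type*} [Lattice α] [AddCommGroup α] [IsOrderedAddMonoid α]
    {x : ℕ → α} (hx : DisjointSeq x) : DisjointSeq fun n => |x n| := by
  intro m n hmn
  simpa only [abs_abs] using hx m n hmn

end Null

/-! ### Absolute values of disjoint weakly null sequences -/

section Disjoint

theorem inf_add_le_inf_add_inf {α : Type*} [Lattice α] [AddCommGroup α] [IsOrderedAddMonoid α]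
    {b c d : α} (hb : 0 ≤ b) (hc : 0 ≤ c) (hd : 0 ≤ d) : b ⊓ (c + d) ≤ b ⊓ c + b ⊓ d := by
  rw [inf_add, add_inf, add_inf]
  refine le_inf (le_inf ?_ ?_) (le_inf ?_ inf_le_right)
  · exact inf_le_left.trans (le_add_of_nonneg_left hb)
  · exact inf_le_left.trans (le_add_of_nonneg_right hd)
  · exact inf_le_left.trans (le_add_of_nonneg_left hc)

theorem inf_sum_eq_zero {α ι : Type*} [Lattice α] [AddCommGroup α] [IsOrderedAddMonoid α]
    {b : α} (hb : 0 ≤ b) {a : ι → α} (ha : ∀ i, 0 ≤ a i) (h : ∀ i, b ⊓ a i = 0)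
    (s : Finset ι) : b ⊓ ∑ i ∈ s, a i = 0 := by
  classical
  induction s using Finset.induction_on with
  | empty => simpa using hb
  | insert i s hi ih =>
    rw [Finset.sum_insert hi]
    have hs : 0 ≤ ∑ i ∈ s, a i := Finset.sum_nonneg fun i _ => ha i
    refine le_antisymm ?_ (le_inf hb (add_nonneg (ha i) hs))
    refine (inf_add_le_inf_add_inf hb (ha i) hs).trans ?_
    rw [h, ih, add_zero]

theorem inf_nsmul_eq_zero {α : Type*} [Lattice α] [AddCommGroup α] [IsOrderedAddMonoid α]
    {b a : α} (hb : 0 ≤ b) (ha : 0 ≤ a) (h : b ⊓ a = 0) (k : ℕ) : b ⊓ k • a = 0 := by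
  simpa using inf_sum_eq_zero hb (a := fun _ : ℕ => a) (fun _ => ha) (fun _ => h) (Finset.range k)

variable {E : Type*}
  [NormedAddCommGroup E] [NormedSpace ℝ E] [Lattice E] [HasSolidNorm E] [IsOrderedAddMonoid E]

/-- A map that is additive on the positive cone, and lies there between `0` and a bounded
functional, extends to a bounded functional. -/
theorem exists_dual_of_additive_on_cone (f : E →L[ℝ] ℝ) (q : E → ℝ)
    (hadd : ∀ a b, 0 ≤ a → 0 ≤ b → q (a + b) = q a + q b)
    (h0 : ∀ a, 0 ≤ a → 0 ≤ q a) (hf : ∀ a, 0 ≤ a → q a ≤ f a) :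
    ∃ g : E →L[ℝ] ℝ, ∀ a, 0 ≤ a → g a = q a := by
  have hq : ∀ {a b c d : E}, 0 ≤ a → 0 ≤ b → 0 ≤ c → 0 ≤ d → a - b = c - d →
      q a - q b = q c - q d := by
    intro a b c d ha hb hc hd h
    have h2 := congrArg q (sub_eq_sub_iff_add_eq_add.1 h)
    rw [hadd _ _ ha hd, hadd _ _ hc hb] at h2
    linarith
  let G : E →+ ℝ := AddMonoidHom.mk' (fun x => q x⁺ - q x⁻) (by
    intro x y
    have h := hq (a := (x + y)⁺) (b := (x + y)⁻) (c := x⁺ + y⁺) (d := x⁻ + y⁻)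
      (posPart_nonneg _) (negPart_nonneg _)
      (add_nonneg (posPart_nonneg _) (posPart_nonneg _))
      (add_nonneg (negPart_nonneg _) (negPart_nonneg _))
      (by rw [posPart_sub_negPart, add_sub_add_comm, posPart_sub_negPart, posPart_sub_negPart])
    rw [hadd _ _ (posPart_nonneg _) (posPart_nonneg _),
      hadd _ _ (negPart_nonneg _) (negPart_nonneg _)] at h
    linarith)
  have hG : ∀ x, ‖G x‖ ≤ ‖f‖ * ‖x‖ := by
    intro x
    have hp := h0 _ (posPart_nonneg x)
    have hn := h0 _ (negPart_nonneg x)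
    have hle : q x⁺ + q x⁻ ≤ ‖f‖ * ‖x‖ := by
      calc q x⁺ + q x⁻ ≤ f |x| := by
            rw [← posPart_add_negPart x, map_add]
            exact add_le_add (hf _ (posPart_nonneg x)) (hf _ (negPart_nonneg x))
        _ ≤ ‖f‖ * ‖|x|‖ := (Real.le_norm_self _).trans (f.le_opNorm _)
        _ = ‖f‖ * ‖x‖ := by rw [norm_abs_eq_norm]
    change ‖q x⁺ - q x⁻‖ ≤ _
    rw [Real.norm_eq_abs, abs_le]
    constructor <;> linarith
  refine ⟨G.toRealLinearMap (AddMonoidHomClass.continuous_of_bound G ‖f‖ hG), fun a ha => ?_⟩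
  have hz : q 0 = 0 := by
    have := hadd 0 0 le_rfl le_rfl
    rw [add_zero] at this
    linarith
  change q a⁺ - q a⁻ = q a
  rw [posPart_of_nonneg ha, negPart_of_nonneg ha, hz, sub_zero]

/-- The component of a positive functional `f` on the band generated by an increasing positive
sequence `u`, `a ↦ sup_k f (a ⊓ u k)` for `a ≥ 0`. The condition `u k + u k ≤ u (k + 1)` makes this
formula additive. -/
theorem exists_band_component {f : E →L[ℝ] ℝ} (hf : 0 ≤ f) {u : ℕ → E} (hu : ∀ k, 0 ≤ u k)
    (hmono : Monotone u) (hdouble : ∀ k, u k + u k ≤ u (k + 1)) :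
    ∃ g : E →L[ℝ] ℝ, ∀ a, 0 ≤ a → Tendsto (fun k => f (a ⊓ u k)) atTop (𝓝 (g a)) := by
  have hm : ∀ a, Monotone fun k => f (a ⊓ u k) := fun a i j hij =>
    apply_le_apply_of_nonneg hf (inf_le_inf_left a (hmono hij))
  have hle : ∀ a k, f (a ⊓ u k) ≤ f a := fun a k => apply_le_apply_of_nonneg hf inf_le_left
  have hbdd : ∀ a, BddAbove (Set.range fun k => f (a ⊓ u k)) := fun a =>
    ⟨f a, by rintro _ ⟨k, rfl⟩; exact hle a k⟩
  have hlim : ∀ a, Tendsto (fun k => f (a ⊓ u k)) atTop (𝓝 (⨆ k, f (a ⊓ u k))) := fun a =>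
    tendsto_atTop_ciSup (hm a) (hbdd a)
  obtain ⟨g, hg⟩ := exists_dual_of_additive_on_cone f (fun a => ⨆ k, f (a ⊓ u k))
    (fun a b ha hb => by
      apply le_antisymm
      · refine le_of_tendsto_of_tendsto' (hlim (a + b)) ((hlim a).add (hlim b)) fun k => ?_
        rw [← map_add]
        refine apply_le_apply_of_nonneg hf ?_
        rw [inf_comm, inf_comm a, inf_comm b]
        exact inf_add_le_inf_add_inf (hu k) ha hb
      · refine le_of_tendsto' ((hlim a).add (hlim b)) fun k => ?_
        rw [← map_add]
        refine le_trans (apply_le_apply_of_nonneg hf ?_) (le_ciSup (hbdd (a + b)) (k + 1))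
        exact le_inf (add_le_add inf_le_left inf_le_left)
          ((add_le_add inf_le_right inf_le_right).trans (hdouble k)))
    (fun a ha => ge_of_tendsto' (hlim a) fun k => hf _ (le_inf ha (hu k)))
    (fun a _ => le_of_tendsto' (hlim a) (hle a))
  exact ⟨g, fun a ha => by rw [hg a ha]; exact hlim a⟩

/-- The functional `g` is the component of `f` on the band generated by the positive parts
`(x n)⁺`; disjointness puts the negative parts into the complementary band. -/
theorem exists_dual_eq_on_posPart {f : E →L[ℝ] ℝ} (hf : 0 ≤ f) {x : ℕ → E}
    (hx : DisjointSeq x) : ∃ g : E →L[ℝ] ℝ, ∀ n, g (x n)⁺ = f (x n)⁺ ∧ g (x n)⁻ = 0 := by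
  let s : ℕ → E := fun k => ∑ i ∈ Finset.range k, (x i)⁺
  have hs : ∀ k, 0 ≤ s k := fun k => Finset.sum_nonneg fun i _ => posPart_nonneg _
  have hsm : Monotone s := fun i j hij =>
    Finset.sum_le_sum_of_subset_of_nonneg (Finset.range_mono hij) fun _ _ _ => posPart_nonneg _
  -- The factor `2 ^ k` makes the partial sums double at each step.
  have hdouble : ∀ k, 2 ^ k • s k + 2 ^ k • s k ≤ 2 ^ (k + 1) • s (k + 1) := by
    intro k
    rw [← two_nsmul, smul_smul, ← pow_succ']
    exact nsmul_le_nsmul_right (hsm k.le_succ) _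
  have hu : ∀ k, 0 ≤ 2 ^ k • s k := fun k => nsmul_nonneg (hs k) _
  have hmono : Monotone fun k => 2 ^ k • s k :=
    monotone_nat_of_le_succ fun k => (le_add_of_nonneg_left (hu k)).trans (hdouble k)
  obtain ⟨g, hg⟩ := exists_band_component hf hu hmono hdouble
  refine ⟨g, fun n => ⟨?_, ?_⟩⟩
  · refine tendsto_nhds_unique (hg _ (posPart_nonneg _)) (tendsto_atTop_of_eventually_const
      (i₀ := n + 1) fun k hk => ?_)
    rw [inf_eq_left.2]
    calc (x n)⁺ ≤ s k := Finset.single_le_sum (f := fun i => (x i)⁺)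
          (fun i _ => posPart_nonneg _) (Finset.mem_range.2 hk)
      _ ≤ 2 ^ k • s k := le_self_nsmul (hs k) (pow_ne_zero _ two_ne_zero)
  · refine tendsto_nhds_unique (hg _ (negPart_nonneg _)) (tendsto_atTop_of_eventually_const
      (i₀ := 0) fun k _ => ?_)
    have h : ∀ i, (x n)⁻ ⊓ (x i)⁺ = 0 := by
      intro i
      rcases eq_or_ne n i with rfl | hni
      · rw [inf_comm]
        exact posPart_inf_negPart_eq_zero (x n)
      · refine le_antisymm ?_ (le_inf (negPart_nonneg _) (posPart_nonneg _))
        rw [← hx n i hni]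
        exact inf_le_inf (sup_le (neg_le_abs _) (abs_nonneg _))
          (sup_le (le_abs_self _) (abs_nonneg _))
    rw [inf_nsmul_eq_zero (negPart_nonneg _) (hs k)
      (inf_sum_eq_zero (negPart_nonneg _) (fun _ => posPart_nonneg _) h _), map_zero]

/-- It suffices to test against `|f|`. For `g` the component of `|f|` that agrees with it on the
positive parts and kills the negative parts, `|f| |x n| = 2 g (x n) - |f| (x n)`. -/
theorem WeakNull.abs_of_disjointSeq {x : ℕ → E} (hx : WeakNull x) (hd : DisjointSeq x) :
    WeakNull fun n => |x n| := by
  rw [weakNull_iff] at hx ⊢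
  intro f
  refine squeeze_zero_norm (a := fun n => |f| |x n|) (fun n => ?_) ?_
  · simpa only [abs_abs, Real.norm_eq_abs] using abs_dual_apply_le f |x n|
  · obtain ⟨g, hg⟩ := exists_dual_eq_on_posPart (dual_abs_nonneg f) hd
    have h : ∀ n, |f| |x n| = 2 * g (x n) - |f| (x n) := by
      intro n
      have h1 : g (x n) = |f| (x n)⁺ := by
        rw [← (hg n).1, ← sub_zero (g (x n)⁺), ← (hg n).2, ← map_sub, posPart_sub_negPart]
      have h2 : |f| (x n) = |f| (x n)⁺ - |f| (x n)⁻ := by rw [← map_sub, posPart_sub_negPart]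
      rw [← posPart_add_negPart (x n), map_add, h1, h2]
      ring
    simp only [h]
    simpa using ((hx g).const_mul 2).sub (hx |f|)

end Disjoint

/-! ### Dominated operators -/

section Domination

variable {E F : Type*}
  [NormedAddCommGroup E] [NormedSpace ℝ E] [Lattice E] [HasSolidNorm E] [IsOrderedAddMonoid E]
  [NormedAddCommGroup F] [NormedSpace ℝ F] [Lattice F] [HasSolidNorm F] [IsOrderedAddMonoid F]

theorem abs_comp_le_of_le {S T : E →L[ℝ] F} (hS : 0 ≤ S) (hST : S ≤ T) (f : StrongDual ℝ F) :
    |f ∘L S| ≤ |f| ∘L T := by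
  intro x hx
  have h : |f ∘L S| ≤ |f| ∘L S :=
    sup_le (fun y hy => le_abs_self f (S y) (hS y hy)) (fun y hy => neg_le_abs f (S y) (hS y hy))
  exact (h x hx).trans (apply_le_apply_of_nonneg (dual_abs_nonneg f) (hST x hx))

theorem abs_comp_le_of_le_of_nonneg {S T : E →L[ℝ] F} (hS : 0 ≤ S) (hST : S ≤ T)
    {f : StrongDual ℝ F} (hf : 0 ≤ f) : |f ∘L S| ≤ f ∘L T := by
  simpa only [abs_of_nonneg hf] using abs_comp_le_of_le hS hST f

theorem WeakStarNull.abs_comp_of_nonneg {f : ℕ → StrongDual ℝ F}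
    (hf : WeakStarNull fun n => |f n|) {S : E →L[ℝ] F} (hS : 0 ≤ S) :
    WeakStarNull fun n => |f n ∘L S| :=
  (hf.comp S).of_abs_le fun n => by
    rw [abs_abs]
    exact abs_comp_le_of_le hS le_rfl (f n)

theorem WeakNull.abs_map_of_nonneg {x : ℕ → E} (hx : WeakNull fun n => |x n|) {S : E →L[ℝ] F}
    (hS : 0 ≤ S) : WeakNull fun n => |S (x n)| :=
  (hx.map S).of_abs_le fun n => by
    rw [abs_abs]
    exact abs_apply_le_of_nonneg hS (x n)

theorem dominationProperty_PSP : DominationProperty (PSP E F) := fun _ _ hS hST hT x hx hw =>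
  (hT x hx hw).of_abs_le fun n => by
    simpa only [abs_of_nonneg (hx n)] using abs_apply_le_of_le hS hST (x n)

theorem dominationProperty_DPSP : DominationProperty (DPSP E F) := fun _ _ hS hST hT f hf hw =>
  (hT f hf hw).of_abs_le fun n => abs_comp_le_of_le_of_nonneg hS hST (hf n)

theorem dominationProperty_DDSP (hF : PropertyD F) : DominationProperty (DDSP E F) :=
  fun _ _ hS hST hT f hd hw =>
    (hT _ hd.abs (hF f hd hw)).of_abs_le fun n => abs_comp_le_of_le hS hST (f n)

theorem dominationProperty_PGP : DominationProperty (PGP E F) := fun _ _ hS hST hT f hf hw =>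
  (hT f hf hw).of_abs_le fun n => abs_comp_le_of_le_of_nonneg hS hST (hf n)

theorem dominationProperty_DGP (hF : PropertyD F) : DominationProperty (DGP E F) :=
  fun _ _ hS hST hT f hd hw =>
    (hT _ hd.abs (hF f hd hw)).of_abs_le fun n => abs_comp_le_of_le hS hST (f n)

/-- Every positive operator belongs to `DSWL E F`, because disjoint weakly null sequences have
weakly null absolute values. -/
theorem dominationProperty_DSWL : DominationProperty (DSWL E F) := fun _ _ hS _ _ _ hd hw =>
  (hw.abs_of_disjointSeq hd).abs_map_of_nonneg hS

theorem dominationProperty_SWL (hE : SeqWeakContLatticeOps E) : DominationProperty (SWL E F) :=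
  fun _ _ hS _ _ x hw => (hE x hw).abs_map_of_nonneg hS

theorem dominationProperty_SWstarL (hF : DualSeqWeakStarContLatticeOps F) :
    DominationProperty (SWstarL E F) :=
  fun _ _ hS _ _ f hw => (hF f hw).abs_comp_of_nonneg hS

theorem dominationProperty_DOp (hF : PropertyD F) : DominationProperty (DOp E F) :=
  fun _ _ hS _ _ f hd hw => (hF f hd hw).abs_comp_of_nonneg hS

theorem dominationProperty_BiSP : DominationProperty (BiSP E F) := by
  intro S T hS hST hT f x hf hw hd hx
  refine squeeze_zero_norm (fun n => ?_) (hT f _ hf hw hd.abs (hx.abs_of_disjointSeq hd))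
  exact (abs_apply_le_of_nonneg (hf n) _).trans
    (apply_le_apply_of_nonneg (hf n) (abs_apply_le_of_le hS hST (x n)))

end Domination

end BanachLatticeOps

theorem theorem3p1 {E F : Type*}
    [NormedAddCommGroup E] [NormedSpace ℝ E] [CompleteSpace E]
    [Lattice E] [HasSolidNorm E] [IsOrderedAddMonoid E] [IsOrderedModule ℝ E]
    [NormedAddCommGroup F] [NormedSpace ℝ F] [CompleteSpace F]
    [Lattice F] [HasSolidNorm F] [IsOrderedAddMonoid F] [IsOrderedModule ℝ F] :
    BanachLatticeOps.DominationProperty (BanachLatticeOps.PSP E F) ∧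
    BanachLatticeOps.DominationProperty (BanachLatticeOps.DPSP E F) ∧
    (BanachLatticeOps.PropertyD F →
      BanachLatticeOps.DominationProperty (BanachLatticeOps.DDSP E F)) ∧
    BanachLatticeOps.DominationProperty (BanachLatticeOps.PGP E F) ∧
    (BanachLatticeOps.PropertyD F →
      BanachLatticeOps.DominationProperty (BanachLatticeOps.DGP E F)) ∧
    BanachLatticeOps.DominationProperty (BanachLatticeOps.DSWL E F) ∧
    (BanachLatticeOps.SeqWeakContLatticeOps E →
      BanachLatticeOps.DominationProperty (BanachLatticeOps.SWL E F)) ∧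
    (BanachLatticeOps.DualSeqWeakStarContLatticeOps F →
      BanachLatticeOps.DominationProperty (BanachLatticeOps.SWstarL E F)) ∧
    (BanachLatticeOps.PropertyD F →
      BanachLatticeOps.DominationProperty (BanachLatticeOps.DOp E F)) ∧
    BanachLatticeOps.DominationProperty (BanachLatticeOps.BiSP E F) :=
  ⟨BanachLatticeOps.dominationProperty_PSP, BanachLatticeOps.dominationProperty_DPSP,
    BanachLatticeOps.dominationProperty_DDSP, BanachLatticeOps.dominationProperty_PGP,
    BanachLatticeOps.dominationProperty_DGP, BanachLatticeOps.dominationProperty_DSWL,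
    BanachLatticeOps.dominationProperty_SWL, BanachLatticeOps.dominationProperty_SWstarL,
    BanachLatticeOps.dominationProperty_DOp, BanachLatticeOps.dominationProperty_BiSP⟩
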